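/- For a connected graph $G$ on the vertex set $V(G)$, let $d_G(u,v)$ be the distance between $u$ and $v$, let $D(G)=(d_G(u,v))_{u,v}$ be the distance matrix, let $\mathrm{Tr}(G)$ be the diagonal matrix whose $u$-th diagonal entry is the transmission $\sum_{v} d_G(u,v)$, and let $\rho_L(G)$ be the largest eigenvalue of the distance Laplacian matrix $L_D(G)=\mathrm{Tr}(G)-D(G)$. A pendant vertex is a vertex of degree $1$. Let $n,k$ be integers with $2\le k\le n-2$, and let $\mathfrak T(n,k)$ be the set of all trees of order $n$ with exactly $k$ pendant vertices. For integers $t_1,t_2\ge 1$ with $t_1+t_2=k$, let $T(n,k;t_1,t_2)$ be the graph obtained from a path of order $n-k$ by attaching $t_1$ pendant edges at one end of the path and $t_2$ pendant edges at the other end, and let $\mathfrak D(n,k)=\{T(n,k;t_1,t_2) : t_1,t_2\ge 1,\ t_1+t_2=k\}$. **Theorem.** If $T\in\mathfrak T(n,k)$ satisfies $\rho_L(T)\ge\rho_L(T')$ for every $T'\in\mathfrak T(n,k)$, then $T$ is isomorphic to a member of $\mathfrak D(n,k)$. -/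

import Mathlib

namespace DistLap

/-- The transmission of a vertex: the sum of its distances to all vertices
(the distance to itself is `0`). -/
noncomputable def transmission {V : Type*} [Fintype V] (G : SimpleGraph V) (u : V) : ℕ :=
  ∑ v, G.dist u v

/-- The distance matrix `D(G)`. -/
noncomputable def distMatrix {V : Type*} (G : SimpleGraph V) : Matrix V V ℝ :=
  Matrix.of fun u v => (G.dist u v : ℝ)

/-- The distance Laplacian matrix `Tr(G) - D(G)`. -/
noncomputable def distLaplacian {V : Type*} [Fintype V] [DecidableEq V] (G : SimpleGraph V) :
    Matrix V V ℝ :=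
  Matrix.diagonal (fun u => (transmission G u : ℝ)) - distMatrix G

/-- The distance Laplacian spectral radius: the largest eigenvalue of the distance Laplacian. -/
noncomputable def rhoL {V : Type*} [Fintype V] [DecidableEq V] (G : SimpleGraph V) : ℝ :=
  sSup {μ : ℝ | Module.End.HasEigenvalue (Matrix.toLin' (distLaplacian G)) μ}

theorem distLaplacian_isHermitian {V : Type*} [Fintype V] [DecidableEq V]
    (G : SimpleGraph V) : (distLaplacian G).IsHermitian := by
  refine (Matrix.isHermitian_diagonal _).sub ?_
  ext u v
  simp [distMatrix, SimpleGraph.dist_comm]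

/-- The supremum in the definition of `rhoL` is a maximum. -/
theorem isGreatest_rhoL {V : Type*} [Fintype V] [DecidableEq V] [Nonempty V]
    (G : SimpleGraph V) :
    IsGreatest {μ : ℝ | Module.End.HasEigenvalue (Matrix.toLin' (distLaplacian G)) μ}
      (rhoL G) := by
  have h : {μ : ℝ | Module.End.HasEigenvalue (Matrix.toLin' (distLaplacian G)) μ} =
      Set.range (distLaplacian_isHermitian G).eigenvalues := by
    rw [← (distLaplacian_isHermitian G).spectrum_real_eq_range_eigenvalues]
    ext μ
    rw [Set.mem_ofPred_eq, Module.End.hasEigenvalue_iff_mem_spectrum, Matrix.spectrum_toLin']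
  have hf : (Set.range (distLaplacian_isHermitian G).eigenvalues).Finite := Set.finite_range _
  rw [rhoL, h]
  exact ⟨(Set.range_nonempty _).csSup_mem hf, fun _ hx => le_csSup hf.bddAbove hx⟩

open Classical in
/-- The number of pendant vertices, i.e. of vertices of degree one. -/
noncomputable def pendantCount {V : Type*} [Fintype V] (G : SimpleGraph V) : ℕ :=
  (Finset.univ.filter fun v : V => G.degree v = 1).card

/-- The trees on the vertex set `V` with exactly `k` pendant vertices. -/
def treesWithPendants (V : Type*) [Fintype V] (k : ℕ) : Set (SimpleGraph V) :=
  {T | T.IsTree ∧ pendantCount T = k}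

/-- The directed relation generating the edges of `brush ℓ t₁ t₂`: consecutive path vertices,
the first path vertex with the `t₁` pendant vertices, the last one with the `t₂` others. -/
def brushRel (ℓ t₁ t₂ : ℕ) : Fin ℓ ⊕ (Fin t₁ ⊕ Fin t₂) → Fin ℓ ⊕ (Fin t₁ ⊕ Fin t₂) → Prop
  | .inl i, .inl j => (i : ℕ) + 1 = j
  | .inl i, .inr (.inl _) => (i : ℕ) = 0
  | .inl i, .inr (.inr _) => (i : ℕ) + 1 = ℓ
  | _, _ => False

/-- The graph obtained from a path of order `ℓ` by attaching `t₁` pendant edges at one end and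
`t₂` pendant edges at the other end. -/
def brush (ℓ t₁ t₂ : ℕ) : SimpleGraph (Fin ℓ ⊕ (Fin t₁ ⊕ Fin t₂)) :=
  SimpleGraph.fromRel (brushRel ℓ t₁ t₂)

/-- `G` belongs, up to isomorphism, to the family of graphs `T(n, k; t₁, t₂)` with
`t₁, t₂ ≥ 1` and `t₁ + t₂ = k`, whose path has order `ℓ = n - k ≥ 2`. -/
def IsInD {V : Type*} (n k : ℕ) (G : SimpleGraph V) : Prop :=
  ∃ ℓ t₁ t₂ : ℕ, 2 ≤ ℓ ∧ ℓ + k = n ∧ 1 ≤ t₁ ∧ 1 ≤ t₂ ∧ t₁ + t₂ = k ∧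
    Nonempty (G ≃g brush ℓ t₁ t₂)

end DistLap

/-! ### Quadratic form of the distance Laplacian and its extremal characterisation. -/

namespace DistLap

open Finset Matrix

variable {V : Type*} [Fintype V] [DecidableEq V]

/-! Suppose a maximal tree has a vertex `a` with neighbours `h`, `b`, `c`, where `b` and `c` are not
leaves. Detach the branch at `h` from `a` and hang it on `b`, or else on `c`; both results are trees
with as many leaves. Only distances between the branch and its complement change, and since `2
d(a,v) ≤ d(b,v) + d(c,v)`, the two new energies of any vector sum to at least twice the old one
(`two_mul_dist_le_dist_moveBranch`).

For an eigenvector `x` of the largest eigenvalue, maximality forces equality. Hence `x` is constant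
on the branch together with `a`, and is an eigenvector of the moved tree for the same eigenvalue.
Comparing the two eigenvalue equations row by row makes `x` constant everywhere, so its energy is
zero, contradicting `rhoL_pos`.

So `NoInnerBranching` holds. As at least two vertices are not leaves, a longest path has at least
two inner vertices; every vertex off the path is then a leaf at its first or last inner vertex,
which gives a `brush`. -/

theorem distLaplacian_mulVec_apply (G : SimpleGraph V) (x : V → ℝ) (u : V) :
    (distLaplacian G *ᵥ x) u = ∑ v, (G.dist u v : ℝ) * (x u - x v) := by
  rw [distLaplacian, Matrix.sub_mulVec, Pi.sub_apply, Matrix.mulVec_diagonal]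
  simp only [distMatrix, Matrix.mulVec, dotProduct, Matrix.of_apply, transmission]
  push_cast
  rw [Finset.sum_mul, ← Finset.sum_sub_distrib]
  exact Finset.sum_congr rfl fun _ _ => by ring

/-- The energy of a vector with respect to the distances, twice the quadratic form of the
distance Laplacian. -/
noncomputable def energy (G : SimpleGraph V) (x : V → ℝ) : ℝ :=
  ∑ u, ∑ v, (G.dist u v : ℝ) * (x u - x v) ^ 2

theorem two_mul_dotProduct_distLaplacian (G : SimpleGraph V) (x : V → ℝ) :
    2 * (x ⬝ᵥ (distLaplacian G *ᵥ x)) = energy G x := by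
  have h1 : x ⬝ᵥ (distLaplacian G *ᵥ x) = ∑ u, ∑ v, (G.dist u v : ℝ) * (x u - x v) * x u := by
    simp only [dotProduct, distLaplacian_mulVec_apply, Finset.mul_sum]
    exact Finset.sum_congr rfl fun _ _ => Finset.sum_congr rfl fun _ _ => by ring
  have h2 : x ⬝ᵥ (distLaplacian G *ᵥ x) = ∑ u, ∑ v, (G.dist u v : ℝ) * (x v - x u) * x v := by
    rw [h1, Finset.sum_comm]
    exact Finset.sum_congr rfl fun _ _ => Finset.sum_congr rfl fun _ _ => by
      rw [SimpleGraph.dist_comm]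
  rw [two_mul]
  nth_rw 1 [h1]
  rw [h2, energy, ← Finset.sum_add_distrib]
  refine Finset.sum_congr rfl fun u _ => ?_
  rw [← Finset.sum_add_distrib]
  exact Finset.sum_congr rfl fun _ _ => by ring

theorem energy_of_eigenvector {G : SimpleGraph V} {x : V → ℝ}
    (hx : distLaplacian G *ᵥ x = rhoL G • x) : energy G x = 2 * (rhoL G * (x ⬝ᵥ x)) := by
  rw [← two_mul_dotProduct_distLaplacian, hx, dotProduct_smul, smul_eq_mul]

variable [Nonempty V]

theorem exists_eigenvector_rhoL (G : SimpleGraph V) :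
    ∃ x : V → ℝ, x ≠ 0 ∧ distLaplacian G *ᵥ x = rhoL G • x := by
  obtain ⟨x, hx⟩ := Module.End.HasEigenvalue.exists_hasEigenvector (isGreatest_rhoL G).1
  exact ⟨x, hx.2, by simpa using hx.apply_eq_smul⟩

/-- An eigenvalue `μ` of the difference gives the eigenvalue `rhoL G - μ` of the distance Laplacian,
which is at most `rhoL G`. -/
theorem posSemidef_rhoL_sub (G : SimpleGraph V) :
    (rhoL G • (1 : Matrix V V ℝ) - distLaplacian G).PosSemidef := by
  have hH : (rhoL G • (1 : Matrix V V ℝ) - distLaplacian G).IsHermitian :=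
    (Matrix.isHermitian_one.smul (by simp [IsSelfAdjoint])).sub (distLaplacian_isHermitian G)
  rw [hH.posSemidef_iff_eigenvalues_nonneg]
  intro i
  have hi := hH.mulVec_eigenvectorBasis i
  set y : V → ℝ := (hH.eigenvectorBasis i).ofLp with hy
  have hy0 : y ≠ 0 := by
    have := hH.eigenvectorBasis.toBasis.ne_zero i
    simpa [hy] using this
  rw [Matrix.sub_mulVec, Matrix.smul_mulVec, Matrix.one_mulVec] at hi
  have hev : Module.End.HasEigenvalue (Matrix.toLin' (distLaplacian G))
      (rhoL G - hH.eigenvalues i) := by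
    refine Module.End.hasEigenvalue_of_hasEigenvector (x := y) ⟨?_, hy0⟩
    rw [Module.End.mem_eigenspace_iff, Matrix.toLin'_apply, sub_smul]
    rw [← hi]
    abel
  have := (isGreatest_rhoL G).2 hev
  simp only [Pi.zero_apply]
  linarith

theorem energy_le (G : SimpleGraph V) (x : V → ℝ) :
    energy G x ≤ 2 * (rhoL G * (x ⬝ᵥ x)) := by
  have h := (posSemidef_rhoL_sub G).dotProduct_mulVec_nonneg x
  rw [Matrix.sub_mulVec, Matrix.smul_mulVec, Matrix.one_mulVec, dotProduct_sub,
    dotProduct_smul, star_trivial, smul_eq_mul] at h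
  rw [← two_mul_dotProduct_distLaplacian]
  linarith

/-- A positive semidefinite form vanishes only on the kernel of its matrix. -/
theorem eigenvector_of_energy_eq (G : SimpleGraph V) (x : V → ℝ)
    (hx : energy G x = 2 * (rhoL G * (x ⬝ᵥ x))) :
    distLaplacian G *ᵥ x = rhoL G • x := by
  have h := (posSemidef_rhoL_sub G).dotProduct_mulVec_zero_iff x
  rw [Matrix.sub_mulVec, Matrix.smul_mulVec, Matrix.one_mulVec, dotProduct_sub,
    dotProduct_smul, star_trivial, smul_eq_mul, sub_eq_zero, sub_eq_zero] at h
  rw [← two_mul_dotProduct_distLaplacian] at hx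
  exact (h.1 (by linarith)).symm

theorem rhoL_pos {G : SimpleGraph V} {u v : V} (h : 0 < G.dist u v) : 0 < rhoL G := by
  have huv : u ≠ v := by rintro rfl; simp at h
  have h1 := energy_le G (Pi.single u 1)
  have h2 : 0 < energy G (Pi.single u 1) := by
    refine Finset.sum_pos' (fun i _ => Finset.sum_nonneg fun j _ => by positivity)
      ⟨u, Finset.mem_univ _, Finset.sum_pos' (fun j _ => by positivity) ⟨v, Finset.mem_univ _, ?_⟩⟩
    simp [huv.symm, h]
  simp at h1
  linarith

end DistLap
-- Distances and leaves in a tree when a branch is moved.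
namespace DistLap

open SimpleGraph

section Tree

variable {V : Type*}

theorem _root_.SimpleGraph.IsAcyclic.length_eq_dist {G : SimpleGraph V} (hG : G.IsAcyclic)
    {u v : V} {p : G.Walk u v} (hp : p.IsPath) : p.length = G.dist u v := by
  obtain ⟨q, hq, hl⟩ := Reachable.exists_path_of_dist ⟨p⟩
  rw [← hl, Subtype.mk.inj ((hG.subsingleton_path u v).elim ⟨p, hp⟩ ⟨q, hq⟩)]

theorem _root_.SimpleGraph.IsAcyclic.dist_eq_of_le {G H : SimpleGraph V} (hG : G.IsAcyclic)
    (hle : H ≤ G) {u v : V} (h : H.Reachable u v) : G.dist u v = H.dist u v := by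
  obtain ⟨p, hp, hl⟩ := h.exists_path_of_dist
  rw [← hl, ← Walk.length_mapLe hle p]
  exact (hG.length_eq_dist ((Walk.isPath_mapLe hle).2 hp)).symm

/-- A tree distance is convex along two edges. -/
theorem _root_.SimpleGraph.IsTree.two_mul_dist_le {G : SimpleGraph V} (hG : G.IsTree) {a b c : V}
    (hb : G.Adj a b) (hc : G.Adj a c) (hbc : b ≠ c) (v : V) :
    2 * G.dist a v ≤ G.dist b v + G.dist c v := by
  rw [dist_comm (u := a), dist_comm (u := b), dist_comm (u := c)]
  by_contra hlt
  -- Adjacent distances differ by exactly one, so failure puts both `b` and `c` nearer to `v` than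
  -- `a`. That yields two paths from `v` to `a` with different penultimate vertices.
  have key : ∀ {d : V}, G.Adj a d → G.dist v a = G.dist v d + 1 →
      ∃ p : G.Walk v a, p.IsPath ∧ p.penultimate = d := by
    intro d hd h
    obtain ⟨p, hp⟩ := hG.connected.exists_walk_length_eq_dist v d
    exact ⟨p.concat hd.symm, Walk.isPath_of_length_eq_dist _ (by simp [hp, h]), by simp⟩
  have h1 := hG.dist_eq_dist_add_one_of_adj v hb
  have h2 := hG.dist_eq_dist_add_one_of_adj v hc
  obtain ⟨p, hp, rfl⟩ := key hb (by omega)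
  obtain ⟨q, hq, rfl⟩ := key hc (by omega)
  exact hbc (by rw [Subtype.mk.inj ((hG.isAcyclic.subsingleton_path v a).elim ⟨p, hp⟩ ⟨q, hq⟩)])

/-- Geodesics in the two components, joined by the new edge, form a path, and every path in an
acyclic graph is a geodesic. -/
theorem dist_sup_edge {F : SimpleGraph V} {h p u v : V}
    (hac : (F ⊔ edge p h).IsAcyclic) (hhp : ¬ F.Reachable h p)
    (hu : F.Reachable h u) (hv : F.Reachable p v) :
    (F ⊔ edge p h).dist u v = F.dist u h + 1 + F.dist p v := by
  have hne : p ≠ h := by rintro rfl; exact hhp (Reachable.refl _)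
  obtain ⟨r, hr, hrl⟩ := hu.symm.exists_path_of_dist
  obtain ⟨s, hs, hsl⟩ := hv.exists_path_of_dist
  have hle : F ≤ F ⊔ edge p h := le_sup_left
  have hadj : (F ⊔ edge p h).Adj h p := by simp [edge_adj, hne.symm]
  set w := (r.mapLe hle).append (Walk.cons hadj (s.mapLe hle)) with hw
  have hpath : w.IsPath := by
    rw [Walk.isPath_def, hw, Walk.support_append, Walk.support_cons, List.tail_cons,
      Walk.support_mapLe_eq_support, Walk.support_mapLe_eq_support, List.nodup_append']
    refine ⟨hr.support_nodup, hs.support_nodup, fun x hx hx' => hhp ?_⟩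
    classical
    exact (Reachable.trans ⟨s.takeUntil x hx'⟩ ⟨r.dropUntil x hx⟩).symm
  rw [← hac.length_eq_dist hpath, hw, Walk.length_append, Walk.length_cons, Walk.length_mapLe,
    Walk.length_mapLe, hrl, hsl]
  ring

/-- The graph in which the branch hanging off `a` through the edge `ah` hangs off `p` instead. -/
def moveBranch (G : SimpleGraph V) (a h p : V) : SimpleGraph V :=
  G.deleteEdges {s(a, h)} ⊔ edge p h

theorem moveBranch_adj {G : SimpleGraph V} {a h p v w : V} :
    (moveBranch G a h p).Adj v w ↔
      (G.Adj v w ∧ s(v, w) ≠ s(a, h)) ∨ ((v = p ∧ w = h ∨ v = h ∧ w = p) ∧ v ≠ w) := by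
  simp [moveBranch, edge_adj]

theorem moveBranch_self {G : SimpleGraph V} {a h : V} (hah : G.Adj a h) :
    moveBranch G a h a = G := by
  ext v w
  rw [moveBranch_adj]
  constructor
  · rintro (h1 | ⟨⟨rfl, rfl⟩ | ⟨rfl, rfl⟩, -⟩)
    exacts [h1.1, hah, hah.symm]
  · intro h1
    by_cases h2 : s(v, w) = s(a, h)
    · right
      have := h1.ne
      simpa [this] using h2
    · exact Or.inl ⟨h1, h2⟩

/-- The vertices of the branch hanging off `a` through the edge `ah`. -/
def branch (G : SimpleGraph V) (a h : V) : Set V :=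
  {v | (G.deleteEdges {s(a, h)}).Reachable h v}

section

variable {G : SimpleGraph V} (hG : G.IsTree) {a h : V} (hah : G.Adj a h)

theorem mem_branch_self : h ∈ branch G a h := Reachable.refl _

include hG hah

theorem notMem_branch : a ∉ branch G a h := fun h1 =>
  isAcyclic_iff_forall_adj_isBridge.1 hG.isAcyclic hah h1.symm

theorem reachable_of_notMem_branch {v : V} (hv : v ∉ branch G a h) :
    (G.deleteEdges {s(a, h)}).Reachable a v := by
  obtain ⟨w⟩ := hG.connected v a
  have : ∀ {x y : V}, G.Walk x y → y = a → x ∉ branch G a h →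
      (G.deleteEdges {s(a, h)}).Reachable a x := by
    intro x y w
    induction w with
    | nil => rintro rfl -; exact Reachable.refl _
    | @cons x y z hxy w ih =>
      intro hz hx
      by_cases he : s(x, y) = s(a, h)
      · rcases Sym2.eq_iff.1 he with ⟨rfl, rfl⟩ | ⟨rfl, rfl⟩
        · exact Reachable.refl _
        · exact absurd mem_branch_self hx
      · have hadj : (G.deleteEdges {s(a, h)}).Adj x y := by simp [hxy, he]
        exact (ih hz fun hy => hx (Reachable.trans hy hadj.symm.reachable)).trans
          hadj.symm.reachable
  exact this w rfl hv

theorem reachable_of_notMem_branch₂ {u v : V} (hu : u ∉ branch G a h) (hv : v ∉ branch G a h) :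
    (G.deleteEdges {s(a, h)}).Reachable u v :=
  (reachable_of_notMem_branch hG hah hu).symm.trans (reachable_of_notMem_branch hG hah hv)

theorem adj_notMem_branch {b : V} (hab : G.Adj a b) (hbh : b ≠ h) : b ∉ branch G a h := by
  intro hb
  refine notMem_branch hG hah (Reachable.trans hb (Adj.reachable ?_))
  have := hab.ne
  simp only [deleteEdges_adj, hab.symm, true_and, Set.mem_singleton_iff, Sym2.eq_iff]
  tauto

variable {p : V} (hp : p ∉ branch G a h)

include hp

theorem isTree_moveBranch : (moveBranch G a h p).IsTree := by
  have := hG.connected.nonempty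
  have hne : p ≠ h := by rintro rfl; exact hp mem_branch_self
  have hle : G.deleteEdges {s(a, h)} ≤ moveBranch G a h p := le_sup_left
  refine ⟨⟨fun u v => ?_⟩, IsAcyclic.sup_edge_of_not_reachable (fun hr => hp hr.symm)
    (hG.isAcyclic.anti (deleteEdges_le _))⟩
  have key : ∀ x, (moveBranch G a h p).Reachable h x := by
    intro x
    by_cases hx : x ∈ branch G a h
    · exact Reachable.mono hle hx
    · refine Reachable.trans (Adj.reachable ?_)
        ((reachable_of_notMem_branch₂ hG hah hp hx).mono hle)
      simp [moveBranch_adj, hne.symm]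
  exact (key u).symm.trans (key v)

theorem dist_moveBranch_of_mem {u v : V} (hu : u ∈ branch G a h) (hv : v ∈ branch G a h) :
    (moveBranch G a h p).dist u v = G.dist u v := by
  have hr : (G.deleteEdges {s(a, h)}).Reachable u v := Reachable.trans (Reachable.symm hu) hv
  rw [hG.isAcyclic.dist_eq_of_le (deleteEdges_le _) hr,
    (isTree_moveBranch hG hah hp).isAcyclic.dist_eq_of_le le_sup_left hr]

theorem dist_moveBranch_of_notMem {u v : V} (hu : u ∉ branch G a h) (hv : v ∉ branch G a h) :
    (moveBranch G a h p).dist u v = G.dist u v := by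
  have hr := reachable_of_notMem_branch₂ hG hah hu hv
  rw [hG.isAcyclic.dist_eq_of_le (deleteEdges_le _) hr,
    (isTree_moveBranch hG hah hp).isAcyclic.dist_eq_of_le le_sup_left hr]

theorem dist_moveBranch_of_mem_of_notMem {u v : V} (hu : u ∈ branch G a h)
    (hv : v ∉ branch G a h) :
    (moveBranch G a h p).dist u v = G.dist u h + 1 + G.dist p v := by
  have hr := reachable_of_notMem_branch₂ hG hah hp hv
  rw [hG.isAcyclic.dist_eq_of_le (deleteEdges_le _) hr,
    hG.isAcyclic.dist_eq_of_le (deleteEdges_le _) (Reachable.symm hu)]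
  exact dist_sup_edge (isTree_moveBranch hG hah hp).isAcyclic hp hu hr

end

/-- The case `p = a` of the previous formula, where nothing moves. -/
theorem dist_of_mem_of_notMem_branch {G : SimpleGraph V} (hG : G.IsTree) {a h : V}
    (hah : G.Adj a h) {u v : V} (hu : u ∈ branch G a h) (hv : v ∉ branch G a h) :
    G.dist u v = G.dist u h + 1 + G.dist a v := by
  have := dist_moveBranch_of_mem_of_notMem hG hah (notMem_branch hG hah) hu hv
  rwa [moveBranch_self hah] at this

variable [Fintype V]

/-- Only `a`, `b`, `h` change neighbours: `a` keeps `b` and `c`, `b` keeps `a` and `b'`, and `h`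
trades `a` for `b`. -/
theorem pendantCount_moveBranch {G : SimpleGraph V} (hG : G.IsTree) {a h b c : V}
    (hh : G.Adj a h) (hb : G.Adj a b) (hc : G.Adj a c) (hbh : b ≠ h) (hch : c ≠ h) (hbc : b ≠ c)
    {b' : V} (hb' : G.Adj b b') (hba : b' ≠ a) :
    pendantCount (moveBranch G a h b) = pendantCount G := by
  classical
  -- A triangle `a`, `b`, `h` would violate convexity as seen from `b`: `2 ≤ 1 + 0`.
  have hnbh : ¬ G.Adj b h := fun h1 => by
    have := hG.two_mul_dist_le hh hb hbh.symm b
    rw [dist_eq_one_iff_adj.2 hb, dist_eq_one_iff_adj.2 h1.symm, dist_self] at this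
    omega
  have hne : b ≠ a := hb.ne.symm
  have hha : h ≠ a := hh.ne.symm
  have hca : c ≠ a := hc.ne.symm
  unfold pendantCount
  congr 1
  ext v
  simp only [Finset.mem_filter, Finset.mem_univ, true_and]
  rw [degree_eq_one_iff_existsUnique_adj, degree_eq_one_iff_existsUnique_adj]
  by_cases hva : v = a
  · subst hva
    refine iff_of_false (fun hx => hbc (hx.unique ?_ ?_)) (fun hx => hbc (hx.unique hb hc)) <;>
      · rw [moveBranch_adj]
        left
        simp [*]
  by_cases hvb : v = b
  · subst hvb
    refine iff_of_false (fun hx => hba (hx.unique ?_ ?_)) (fun hx => hba (hx.unique hb' hb.symm)) <;>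
      · rw [moveBranch_adj]
        left
        simp [*, hb.symm]
  by_cases hvh : v = h
  · subst hvh
    have h1 : ∀ w, (moveBranch G a v b).Adj v w ↔ (G.Adj v w ∧ w ≠ a) ∨ w = b := by
      intro w
      rw [moveBranch_adj]
      simp only [ne_eq, Sym2.eq_iff, hva, hvb]
      grind
    simp only [h1]
    constructor
    · rintro ⟨w, -, hw⟩
      refine ⟨a, hh.symm, fun x hx => ?_⟩
      by_contra hxa
      have e1 := hw x (Or.inl ⟨hx, hxa⟩)
      have e2 := hw b (Or.inr rfl)
      exact hnbh (by rw [e2, ← e1]; exact hx.symm)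
    · rintro ⟨w, -, hw⟩
      refine ⟨b, Or.inr rfl, ?_⟩
      rintro x (⟨hx, hxa⟩ | hx)
      · exact absurd ((hw x hx).trans (hw a hh.symm).symm) hxa
      · exact hx
  · have h1 : ∀ w, (moveBranch G a h b).Adj v w ↔ G.Adj v w := by
      intro w
      rw [moveBranch_adj]
      simp [hva, hvb, hvh]
    simp only [h1]

end Tree

end DistLap
-- Trees without inner branching are brushes.
namespace DistLap

open SimpleGraph

section Brush

variable {V : Type*} {G : SimpleGraph V}

/-- A vertex with exactly one neighbour. -/
def IsLeaf (G : SimpleGraph V) (v : V) : Prop := ∃! w, G.Adj v w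

theorem pendantCount_eq_card_isLeaf [Fintype V] :
    pendantCount G = Nat.card {v // IsLeaf G v} := by
  classical
  rw [Nat.card_eq_fintype_card, Fintype.card_subtype, pendantCount]
  simp only [degree_eq_one_iff_existsUnique_adj, IsLeaf]
  congr!

theorem IsLeaf.eq {v x y : V} (h : IsLeaf G v) (hx : G.Adj v x) (hy : G.Adj v y) : x = y :=
  h.unique hx hy

theorem exists_adj_ne_of_not_isLeaf {v a : V} (h : ¬ IsLeaf G v) (ha : G.Adj v a) :
    ∃ y, G.Adj v y ∧ y ≠ a := by
  by_contra! hc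
  exact h ⟨a, ha, hc⟩

/-- The second vertex of a path from `x` to `y` is `y` itself or an inner vertex of the path, which
has two neighbours. -/
theorem exists_adj_not_isLeaf (hG : G.Connected) {x y : V} (hxy : x ≠ y)
    (hy : ¬ IsLeaf G y) :
    ∃ z, G.Adj x z ∧ ¬ IsLeaf G z := by
  obtain ⟨p, hp⟩ := hG.exists_isPath x y
  match p, hp with
  | .nil, _ => exact absurd rfl hxy
  | .cons h .nil, _ => exact ⟨_, h, hy⟩
  | .cons (v := z) h (.cons (v := w) h' p), hp =>
    refine ⟨z, h, fun hl => ?_⟩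
    have hxw : x = w := hl.eq h.symm h'
    subst hxw
    simp at hp

theorem exists_isPath_length_eq_three (hG : G.IsTree) {x y : V} (hxy : x ≠ y)
    (hx : ¬ IsLeaf G x) (hy : ¬ IsLeaf G y) :
    ∃ (u v : V) (p : G.Walk u v), p.IsPath ∧ p.length = 3 := by
  obtain ⟨z, hxz, hz⟩ := exists_adj_not_isLeaf hG.connected hxy hy
  obtain ⟨s, hs, hsz⟩ := exists_adj_ne_of_not_isLeaf hx hxz
  obtain ⟨t, ht, htx⟩ := exists_adj_ne_of_not_isLeaf hz hxz.symm
  have hst : s ≠ t := by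
    rintro rfl
    have := hG.two_mul_dist_le hs hxz hsz z
    rw [dist_eq_one_iff_adj.2 hxz, dist_eq_one_iff_adj.2 ht.symm, dist_self] at this
    omega
  refine ⟨s, t, .cons hs.symm (.cons hxz (.cons ht .nil)), ?_, rfl⟩
  simp [Walk.cons_isPath_iff, hs.ne.symm, hsz, hst, hxz.ne, htx.symm, ht.ne]

/-- No vertex has two neighbours that are not leaves and yet a third neighbour. -/
def NoInnerBranching (G : SimpleGraph V) : Prop :=
  ∀ ⦃a h b c : V⦄, G.Adj a h → G.Adj a b → G.Adj a c → b ≠ h → c ≠ h → b ≠ c →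
    ¬ IsLeaf G b → ¬ IsLeaf G c → False

/-- A spine of a graph is an injective list of at least two non-leaves such that all other
vertices are leaves attached to its ends. -/
structure IsSpine (G : SimpleGraph V) {ℓ : ℕ} (q : Fin (ℓ + 2) → V) : Prop where
  injective : Function.Injective q
  not_isLeaf : ∀ i, ¬ IsLeaf G (q i)
  adj_iff : ∀ i j, G.Adj (q i) (q j) ↔ (i : ℕ) + 1 = j ∨ (j : ℕ) + 1 = i
  isLeaf_of_adj : ∀ i w, G.Adj (q i) w → w ∉ Set.range q → IsLeaf G w
  eq_of_adj : ∀ i w, G.Adj (q i) w → IsLeaf G w → i = 0 ∨ i = Fin.last _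
  exists_first : ∃ w, G.Adj (q 0) w ∧ IsLeaf G w
  exists_last : ∃ w, G.Adj (q (Fin.last _)) w ∧ IsLeaf G w

theorem brush_adj {ℓ t₁ t₂ : ℕ} {x y} : (brush ℓ t₁ t₂).Adj x y ↔
    x ≠ y ∧ (brushRel ℓ t₁ t₂ x y ∨ brushRel ℓ t₁ t₂ y x) := SimpleGraph.fromRel_adj ..

theorem IsSpine.exists_iso [Fintype V] (hG : G.Connected) {ℓ : ℕ} {q : Fin (ℓ + 2) → V}
    (hq : IsSpine G q) :
    ∃ t₁ t₂ : ℕ, 1 ≤ t₁ ∧ 1 ≤ t₂ ∧ Nonempty (brush (ℓ + 2) t₁ t₂ ≃g G) ∧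
      pendantCount G = t₁ + t₂ := by
  classical
  let A := {w // G.Adj (q 0) w ∧ IsLeaf G w}
  let B := {w // G.Adj (q (Fin.last _)) w ∧ IsLeaf G w}
  let eA : Fin (Fintype.card A) ≃ A := (Fintype.equivFin A).symm
  let eB : Fin (Fintype.card B) ≃ B := (Fintype.equivFin B).symm
  have hAB : ∀ w, G.Adj (q 0) w → IsLeaf G w → ¬ G.Adj (q (Fin.last _)) w := by
    intro w h1 h2 h3
    have := hq.injective (h2.eq h1.symm h3.symm)
    simp [Fin.ext_iff] at this
  let f : Fin (ℓ + 2) ⊕ (Fin (Fintype.card A) ⊕ Fin (Fintype.card B)) → V :=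
    Sum.elim q (Sum.elim (fun i => (eA i : V)) (fun i => (eB i : V)))
  have hA : ∀ i, G.Adj (q 0) (eA i) ∧ IsLeaf G (eA i) := fun i => (eA i).2
  have hB : ∀ i, G.Adj (q (Fin.last _)) (eB i) ∧ IsLeaf G (eB i) := fun i => (eB i).2
  have hinj : Function.Injective f := by
    refine Function.Injective.sumElim hq.injective (Function.Injective.sumElim
      (Subtype.val_injective.comp eA.injective) (Subtype.val_injective.comp eB.injective) ?_) ?_
    · intro i j h
      exact hAB _ (hA i).1 (hA i).2 (by rw [h]; exact (hB j).1)
    · rintro i (j | j) h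
      · exact hq.not_isLeaf i (by rw [h]; exact (hA j).2)
      · exact hq.not_isLeaf i (by rw [h]; exact (hB j).2)
  -- The spine and its end leaves are closed under adjacency, hence exhaust the connected graph.
  have hrange : ∀ v, v ∈ Set.range q ∨ (G.Adj (q 0) v ∧ IsLeaf G v) ∨
      (G.Adj (q (Fin.last _)) v ∧ IsLeaf G v) := by
    intro v
    obtain ⟨w⟩ := hG v (q 0)
    have : ∀ {x y : V}, G.Walk x y → y = q 0 → x ∈ Set.range q ∨ (G.Adj (q 0) x ∧ IsLeaf G x) ∨
      (G.Adj (q (Fin.last _)) x ∧ IsLeaf G x) := by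
      intro x y w
      induction w with
      | nil => rintro rfl; exact Or.inl ⟨0, rfl⟩
      | @cons x y z hxy w ih =>
        intro hz
        rcases ih hz with ⟨i, rfl⟩ | ⟨h1, h2⟩ | ⟨h1, h2⟩
        · by_cases hx : x ∈ Set.range q
          · exact Or.inl hx
          · have hl := hq.isLeaf_of_adj i x hxy.symm hx
            rcases hq.eq_of_adj i x hxy.symm hl with rfl | rfl
            · exact Or.inr (Or.inl ⟨hxy.symm, hl⟩)
            · exact Or.inr (Or.inr ⟨hxy.symm, hl⟩)
        · exact Or.inl ⟨0, h2.eq h1.symm hxy.symm⟩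
        · exact Or.inl ⟨_, h2.eq h1.symm hxy.symm⟩
    exact this w rfl
  have hsurj : Function.Surjective f := by
    intro v
    rcases hrange v with ⟨i, rfl⟩ | h | h
    · exact ⟨.inl i, rfl⟩
    · exact ⟨.inr (.inl (eA.symm ⟨v, h⟩)), by simp [f]⟩
    · exact ⟨.inr (.inr (eB.symm ⟨v, h⟩)), by simp [f]⟩
  have hleaf : ∀ {x y}, IsLeaf G x → IsLeaf G y → ∀ {i}, G.Adj (q i) x → ¬ G.Adj x y := by
    intro x y hx hy i h1 h2
    exact hq.not_isLeaf i (by rw [hx.eq h1.symm h2]; exact hy)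
  have hqA : ∀ i j, G.Adj (q i) (eA j) ↔ (i : ℕ) = 0 := by
    intro i j
    refine ⟨fun h => ?_, fun h => ?_⟩
    · have := hq.injective ((hA j).2.eq h.symm (hA j).1.symm)
      simp [this]
    · have : i = 0 := Fin.ext h
      rw [this]; exact (hA j).1
  have hqB : ∀ i j, G.Adj (q i) (eB j) ↔ (i : ℕ) + 1 = ℓ + 2 := by
    intro i j
    refine ⟨fun h => ?_, fun h => ?_⟩
    · have := hq.injective ((hB j).2.eq h.symm (hB j).1.symm)
      simp [this]
    · have : i = Fin.last _ := Fin.ext (by simpa using h)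
      rw [this]; exact (hB j).1
  let e : Fin (ℓ + 2) ⊕ (Fin (Fintype.card A) ⊕ Fin (Fintype.card B)) ≃ V :=
    Equiv.ofBijective f ⟨hinj, hsurj⟩
  have hadj : ∀ x y, G.Adj (f x) (f y) ↔ (brush (ℓ + 2) _ _).Adj x y := by
    rintro (i | i | i) (j | j | j) <;>
      simp only [f, Sum.elim_inl, Sum.elim_inr, brush_adj, brushRel, hqA, hqB,
        G.adj_comm (eA _ : V) (q _), G.adj_comm (eB _ : V) (q _), hq.adj_iff, ne_eq, reduceCtorEq,
        not_false_eq_true, true_and, or_false, false_or, and_false, iff_false]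
    · refine ⟨fun h => ⟨?_, h⟩, fun h => h.2⟩
      rintro h'
      cases h'
      omega
    · exact hleaf (hA _).2 (hA _).2 (hA _).1
    · exact hleaf (hA _).2 (hB _).2 (hA _).1
    · exact hleaf (hB _).2 (hA _).2 (hB _).1
    · exact hleaf (hB _).2 (hB _).2 (hB _).1
  refine ⟨Fintype.card A, Fintype.card B, ?_, ?_, ⟨⟨e, fun {x y} => hadj x y⟩⟩, ?_⟩
  · obtain ⟨w, hw⟩ := hq.exists_first
    exact Fintype.card_pos_iff.2 ⟨⟨w, hw⟩⟩
  · obtain ⟨w, hw⟩ := hq.exists_last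
    exact Fintype.card_pos_iff.2 ⟨⟨w, hw⟩⟩
  · rw [pendantCount_eq_card_isLeaf, Nat.card_eq_fintype_card, Fintype.card_subtype,
      Finset.card_filter, ← e.sum_comp, Fintype.sum_sum_type, Fintype.sum_sum_type]
    have hf : ∀ z, e z = f z := fun _ => rfl
    simp [hf, f, hq.not_isLeaf, (hA _).2, (hB _).2]

/-- A neighbour off the path would extend it; one on the path must be the second vertex, as there
are no cycles. -/
theorem eq_snd_of_isPath_of_length_le (hG : G.IsTree) {u v : V} {p : G.Walk u v} (hp : p.IsPath)
    (hmax : ∀ (u' v' : V) (p' : G.Walk u' v') (_ : p'.IsPath), p'.length ≤ p.length)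
    {w : V} (hw : G.Adj u w) : w = p.snd := by
  refine hG.isAcyclic.eq_snd_of_adj_start hp hw ?_
  by_contra hs
  have := hmax _ _ _ (hp.cons hs (h := hw.symm))
  simp at this

theorem exists_isSpine [Fintype V] (hG : G.IsTree) (hN : NoInnerBranching G) {x y : V}
    (hxy : x ≠ y) (hx : ¬ IsLeaf G x) (hy : ¬ IsLeaf G y) :
    ∃ (ℓ : ℕ) (q : Fin (ℓ + 2) → V), IsSpine G q := by
  have := hG.connected.nonempty
  obtain ⟨u, v, p, hp, hmax⟩ := Walk.exists_isPath_forall_isPath_length_le_length G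
  obtain ⟨_, _, p', hp', hl'⟩ := exists_isPath_length_eq_three hG hxy hx hy
  have h3 := hmax _ _ _ hp'
  obtain ⟨ℓ, hℓ⟩ : ∃ ℓ, p.length = ℓ + 3 := ⟨p.length - 3, by omega⟩
  set f : ℕ → V := p.getVert with hf
  have finj : ∀ {i j}, i ≤ ℓ + 3 → j ≤ ℓ + 3 → f i = f j → i = j := fun hi hj h =>
    hp.getVert_injOn (by simpa [hℓ] using hi) (by simpa [hℓ] using hj) h
  have fadj : ∀ {i}, i < ℓ + 3 → G.Adj (f i) (f (i + 1)) := fun hi =>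
    p.adj_getVert_succ (by omega)
  have hfirst : ∀ {w}, G.Adj (f 0) w → w = f 1 := by
    intro w hw
    refine eq_snd_of_isPath_of_length_le hG hp hmax ?_
    simpa [hf] using hw
  have hlast : ∀ {w}, G.Adj (f (ℓ + 3)) w → w = f (ℓ + 2) := by
    intro w hw
    have := eq_snd_of_isPath_of_length_le hG hp.reverse (by simpa using hmax) (w := w)
      (by simpa [hf, ← hℓ] using hw)
    rw [this, Walk.snd_reverse, Walk.penultimate, hℓ]
    rfl
  have leaf0 : IsLeaf G (f 0) := ⟨f 1, fadj (by omega), fun _ h => hfirst h⟩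
  have leafl : IsLeaf G (f (ℓ + 3)) :=
    ⟨f (ℓ + 2), (fadj (by omega)).symm, fun _ h => hlast h⟩
  have nleaf : ∀ {i}, i < ℓ + 2 → ¬ IsLeaf G (f (i + 1)) := by
    intro i hi hl
    have := finj (by omega) (by omega) (hl.eq (fadj (i := i) (by omega)).symm
      (fadj (i := i + 1) (by omega)))
    omega
  -- a neighbour that is not the predecessor or the successor
  have hnbr : ∀ {i w}, i < ℓ + 2 → G.Adj (f (i + 1)) w → w ≠ f i → w ≠ f (i + 2) →
      (i = 0 ∨ i = ℓ + 1) ∧ IsLeaf G w := by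
    intro i w hi hw h1 h2
    have hp1 : G.Adj (f (i + 1)) (f i) := (fadj (by omega)).symm
    have hs1 : G.Adj (f (i + 1)) (f (i + 2)) := fadj (by omega)
    have hne : f i ≠ f (i + 2) := fun h => by
      have := finj (by omega) (by omega) h
      omega
    refine ⟨?_, ?_⟩
    -- Away from the ends both path neighbours are inner vertices, so `w` would be a forbidden third
    -- neighbour.
    · by_contra! hc
      obtain ⟨j, rfl⟩ : ∃ j, i = j + 1 := ⟨i - 1, by omega⟩
      exact hN hw hp1 hs1 h1.symm h2.symm hne (nleaf (by omega)) (nleaf (i := j + 2) (by omega))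
    · by_contra hwl
      -- If `w` is not a leaf, pair it with a path neighbour that is not a leaf: the successor when
      -- `i = 0`, the predecessor otherwise. The other path neighbour is the third.
      rcases Nat.eq_zero_or_pos i with rfl | hi0
      · exact hN hp1 hw hs1 h1 hne.symm h2 hwl (nleaf (i := 1) (by omega))
      · obtain ⟨j, rfl⟩ : ∃ j, i = j + 1 := ⟨i - 1, by omega⟩
        exact hN hs1 hw hp1 h2 hne h1 hwl (nleaf (by omega))
  -- The shift by one drops the leaf `f 0`; the range stops before the leaf `f (ℓ + 3)`.
  refine ⟨ℓ, fun i => f (i + 1), ?_, fun i => nleaf i.2, ?_, ?_, ?_, ⟨f 0, ?_, leaf0⟩,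
    ⟨f (ℓ + 3), ?_, leafl⟩⟩
  · intro i j h
    have := finj (by omega) (by omega) h
    exact Fin.ext (by omega)
  · intro i j
    constructor
    · intro h
      by_cases h1 : f (j + 1) = f i
      · have := finj (by omega) (by omega) h1
        omega
      by_cases h2 : f (j + 1) = f (i + 2)
      · have := finj (by omega) (by omega) h2
        omega
      · exact absurd (hnbr i.2 h h1 h2).2 (nleaf j.2)
    · rintro (h | h)
      · rw [← h]; exact fadj (by omega)
      · rw [← h]; exact (fadj (by omega)).symm
  · intro i w hw hwr
    by_cases h1 : w = f i
    · rcases Nat.eq_zero_or_pos (i : ℕ) with h | h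
      · rw [h1, h]; exact leaf0
      · exact absurd ⟨⟨i - 1, by omega⟩, by simp only; rw [h1]; congr 1; omega⟩ hwr
    by_cases h2 : w = f (i + 2)
    · by_cases h : (i : ℕ) = ℓ + 1
      · rw [h2, h]; exact leafl
      · exact absurd ⟨⟨i + 1, by omega⟩, by simp only; rw [h2]⟩ hwr
    exact (hnbr i.2 hw h1 h2).2
  · intro i w hw hwl
    have : (i : ℕ) = 0 ∨ (i : ℕ) = ℓ + 1 := by
      by_cases h1 : w = f i
      · by_contra! hc
        obtain ⟨j, hj⟩ : ∃ j, (i : ℕ) = j + 1 := ⟨i - 1, by omega⟩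
        rw [h1, hj] at hwl
        exact nleaf (by omega) hwl
      by_cases h2 : w = f (i + 2)
      · by_contra! hc
        rw [h2] at hwl
        exact nleaf (i := i + 1) (by omega) hwl
      exact (hnbr i.2 hw h1 h2).1
    exact this.imp (fun h => Fin.ext h) (fun h => Fin.ext h)
  · exact (fadj (i := 0) (by omega)).symm
  · exact fadj (by omega)

theorem isInD_of_noInnerBranching [Fintype V] (hG : G.IsTree) (hN : NoInnerBranching G) {n k : ℕ}
    (hn : Fintype.card V = n) (hk : pendantCount G = k) (hkn : k + 2 ≤ n) : IsInD n k G := by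
  classical
  have hcard : 1 < Fintype.card {v // ¬ IsLeaf G v} := by
    rw [pendantCount_eq_card_isLeaf, Nat.card_eq_fintype_card] at hk
    rw [Fintype.card_subtype_compl]
    omega
  obtain ⟨⟨x, hx⟩, ⟨y, hy⟩, hxy⟩ := Fintype.one_lt_card_iff.1 hcard
  obtain ⟨ℓ, q, hq⟩ := exists_isSpine hG hN (fun h => hxy (Subtype.ext h)) hx hy
  obtain ⟨t₁, t₂, h1, h2, ⟨e⟩, ht⟩ := hq.exists_iso hG.connected
  have he := Fintype.card_congr e.toEquiv
  simp only [Fintype.card_sum, Fintype.card_fin] at he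
  exact ⟨ℓ + 2, t₁, t₂, by omega, by omega, h1, h2, by omega, ⟨e.symm⟩⟩

end Brush

end DistLap
-- Maximality excludes inner branching.
namespace DistLap

open SimpleGraph Matrix

section Maximal

variable {V : Type*} {G : SimpleGraph V}

theorem two_mul_dist_le_dist_moveBranch (hG : G.IsTree) {a h b c : V}
    (hh : G.Adj a h) (hb : G.Adj a b) (hc : G.Adj a c) (hbh : b ≠ h) (hch : c ≠ h) (hbc : b ≠ c)
    (u v : V) :
    2 * G.dist u v ≤ (moveBranch G a h b).dist u v + (moveBranch G a h c).dist u v := by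
  have hbB := adj_notMem_branch hG hh hb hbh
  have hcB := adj_notMem_branch hG hh hc hch
  have key : ∀ {u v}, u ∈ branch G a h → v ∉ branch G a h →
      2 * G.dist u v ≤ (moveBranch G a h b).dist u v + (moveBranch G a h c).dist u v := by
    intro u v hu hv
    rw [dist_moveBranch_of_mem_of_notMem hG hh hbB hu hv,
      dist_moveBranch_of_mem_of_notMem hG hh hcB hu hv, dist_of_mem_of_notMem_branch hG hh hu hv]
    have := hG.two_mul_dist_le hb hc hbc v
    omega
  by_cases hu : u ∈ branch G a h <;> by_cases hv : v ∈ branch G a h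
  · rw [dist_moveBranch_of_mem hG hh hbB hu hv, dist_moveBranch_of_mem hG hh hcB hu hv, two_mul]
  · exact key hu hv
  · have := key hv hu
    rwa [dist_comm, (moveBranch G a h b).dist_comm, (moveBranch G a h c).dist_comm]
  · rw [dist_moveBranch_of_notMem hG hh hbB hu hv, dist_moveBranch_of_notMem hG hh hcB hu hv,
      two_mul]

theorem two_mul_dist_lt_dist_moveBranch (hG : G.IsTree) {a h b c : V}
    (hh : G.Adj a h) (hb : G.Adj a b) (hc : G.Adj a c) (hbh : b ≠ h) (hch : c ≠ h)
    {u : V} (hu : u ∈ branch G a h) :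
    2 * G.dist u a < (moveBranch G a h b).dist u a + (moveBranch G a h c).dist u a := by
  have ha := notMem_branch hG hh
  rw [dist_moveBranch_of_mem_of_notMem hG hh (adj_notMem_branch hG hh hb hbh) hu ha,
    dist_moveBranch_of_mem_of_notMem hG hh (adj_notMem_branch hG hh hc hch) hu ha,
    dist_of_mem_of_notMem_branch hG hh hu ha, dist_eq_one_iff_adj.2 hb.symm,
    dist_eq_one_iff_adj.2 hc.symm, dist_self]
  omega

/-- The excess of the two new energies over twice the old is a sum of nonnegative terms that is at
most zero, so each term vanishes; the weight of a pair `u`, `a` with `u` in the branch is positive.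
-/
theorem eq_on_branch_of_energy_le [Fintype V] (hG : G.IsTree) {a h b c : V}
    (hh : G.Adj a h) (hb : G.Adj a b) (hc : G.Adj a c) (hbh : b ≠ h) (hch : c ≠ h) (hbc : b ≠ c)
    {x : V → ℝ} (hEb : energy (moveBranch G a h b) x ≤ energy G x)
    (hEc : energy (moveBranch G a h c) x ≤ energy G x) :
    energy (moveBranch G a h b) x = energy G x ∧ ∀ u ∈ branch G a h, x u = x a := by
  set D : V → V → ℝ := fun u v => ((moveBranch G a h b).dist u v : ℝ) +
    (moveBranch G a h c).dist u v - 2 * G.dist u v with hD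
  have hD0 : ∀ u v, 0 ≤ D u v := fun u v => by
    have : (2 * G.dist u v : ℝ) ≤ (moveBranch G a h b).dist u v + (moveBranch G a h c).dist u v :=
      mod_cast two_mul_dist_le_dist_moveBranch hG hh hb hc hbh hch hbc u v
    simp only [hD]
    linarith
  have hsum : energy (moveBranch G a h b) x + energy (moveBranch G a h c) x - 2 * energy G x =
      ∑ u, ∑ v, D u v * (x u - x v) ^ 2 := by
    simp only [energy, Finset.mul_sum, ← Finset.sum_add_distrib, ← Finset.sum_sub_distrib, hD]
    exact Finset.sum_congr rfl fun _ _ => Finset.sum_congr rfl fun _ _ => by ring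
  have hnn : ∀ u, 0 ≤ ∑ v, D u v * (x u - x v) ^ 2 := fun u =>
    Finset.sum_nonneg fun v _ => mul_nonneg (hD0 u v) (sq_nonneg _)
  have hnn' := Finset.sum_nonneg fun u (_ : u ∈ Finset.univ) => hnn u
  refine ⟨by linarith, fun u hu => ?_⟩
  have h0 : ∑ u, ∑ v, D u v * (x u - x v) ^ 2 = 0 := by linarith
  have h1 := (Finset.sum_eq_zero_iff_of_nonneg fun u _ => hnn u).1 h0 u (Finset.mem_univ _)
  have h2 := (Finset.sum_eq_zero_iff_of_nonneg fun v _ =>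
    mul_nonneg (hD0 u v) (sq_nonneg _)).1 h1 a (Finset.mem_univ _)
  have hpos : 0 < D u a := by
    have : (2 * G.dist u a : ℝ) < (moveBranch G a h b).dist u a + (moveBranch G a h c).dist u a :=
      mod_cast two_mul_dist_lt_dist_moveBranch hG hh hb hc hbh hch hu
    simp only [hD]
    linarith
  rcases mul_eq_zero.1 h2 with h3 | h3
  · exact absurd h3 hpos.ne'
  · exact sub_eq_zero.1 (pow_eq_zero_iff two_ne_zero |>.1 h3)

/-- For `v` outside the branch, row `v` of the two products differs by `(d(v,b) - d(v,a)) (x v - x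
a)` times the size of the branch, and adjacent vertices of a tree are never equidistant from `v`. -/
theorem eq_of_distLaplacian_moveBranch_eq [Fintype V] [DecidableEq V] (hG : G.IsTree) {a h b : V}
    (hh : G.Adj a h) (hb : G.Adj a b) (hbh : b ≠ h) {x : V → ℝ}
    (hx : distLaplacian (moveBranch G a h b) *ᵥ x = distLaplacian G *ᵥ x)
    (hbr : ∀ u ∈ branch G a h, x u = x a) (v : V) : x v = x a := by
  classical
  by_cases hv : v ∈ branch G a h
  · exact hbr v hv
  have hrow := congrFun hx v
  rw [distLaplacian_mulVec_apply, distLaplacian_mulVec_apply, ← sub_eq_zero,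
    ← Finset.sum_sub_distrib] at hrow
  have hbB := adj_notMem_branch hG hh hb hbh
  have hterm : ∀ u, ((moveBranch G a h b).dist v u : ℝ) * (x v - x u) -
      G.dist v u * (x v - x u) =
      if u ∈ branch G a h then ((G.dist v b : ℝ) - G.dist v a) * (x v - x a) else 0 := by
    intro u
    split_ifs with hu
    · rw [hbr u hu, dist_comm, dist_moveBranch_of_mem_of_notMem hG hh hbB hu hv,
        G.dist_comm (u := v) (v := u), dist_of_mem_of_notMem_branch hG hh hu hv,
        G.dist_comm (u := b), G.dist_comm (u := a)]
      push_cast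
      ring
    · rw [dist_moveBranch_of_notMem hG hh hbB hv hu, sub_self]
  rw [Finset.sum_congr rfl fun u _ => hterm u, ← Finset.sum_filter, Finset.sum_const,
    nsmul_eq_mul] at hrow
  have hcard : (((Finset.univ.filter fun u => u ∈ branch G a h).card : ℕ) : ℝ) ≠ 0 := by
    rw [Nat.cast_ne_zero, Finset.card_ne_zero]
    exact ⟨h, by simp [mem_branch_self]⟩
  have hd : (G.dist v b : ℝ) - G.dist v a ≠ 0 := by
    rw [sub_ne_zero, (Nat.cast_injective (R := ℝ)).ne_iff]
    exact (hG.dist_ne_of_adj v hb).symm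
  have := (mul_eq_zero.1 hrow).resolve_left hcard
  exact sub_eq_zero.1 ((mul_eq_zero.1 this).resolve_left hd)

theorem noInnerBranching_of_maximal [Fintype V] [DecidableEq V] {k : ℕ}
    (hG : G ∈ treesWithPendants V k)
    (hmax : ∀ G' ∈ treesWithPendants V k, rhoL G' ≤ rhoL G) : NoInnerBranching G := by
  intro a h b c hh hb hc hbh hch hbc hbl hcl
  obtain ⟨hT, hk⟩ := hG
  have : Nonempty V := ⟨a⟩
  obtain ⟨b', hb', hb'a⟩ := exists_adj_ne_of_not_isLeaf hbl hb.symm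
  obtain ⟨c', hc', hc'a⟩ := exists_adj_ne_of_not_isLeaf hcl hc.symm
  have hmb := hmax (moveBranch G a h b)
    ⟨isTree_moveBranch hT hh (adj_notMem_branch hT hh hb hbh),
      (pendantCount_moveBranch hT hh hb hc hbh hch hbc hb' hb'a).trans hk⟩
  have hmc := hmax (moveBranch G a h c)
    ⟨isTree_moveBranch hT hh (adj_notMem_branch hT hh hc hch),
      (pendantCount_moveBranch hT hh hc hb hch hbh hbc.symm hc' hc'a).trans hk⟩
  obtain ⟨x, hx0, hx⟩ := exists_eigenvector_rhoL G
  have hxx : 0 < x ⬝ᵥ x := by simpa using (Matrix.dotProduct_star_self_pos_iff (v := x)).2 hx0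
  have hE := energy_of_eigenvector hx
  have hle : ∀ {G' : SimpleGraph V}, rhoL G' ≤ rhoL G → energy G' x ≤ energy G x := by
    intro G' h'
    rw [hE]
    exact (energy_le G' x).trans (by gcongr)
  obtain ⟨hEb, hbr⟩ := eq_on_branch_of_energy_le hT hh hb hc hbh hch hbc (hle hmb) (hle hmc)
  have hrho : rhoL (moveBranch G a h b) = rhoL G := by
    refine le_antisymm hmb ?_
    have h1 := energy_le (moveBranch G a h b) x
    rw [hEb, hE] at h1
    exact le_of_mul_le_mul_right (by linarith) hxx
  have hx' := eigenvector_of_energy_eq (moveBranch G a h b) x (by rw [hEb, hE, hrho])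
  have hconst := eq_of_distLaplacian_moveBranch_eq hT hh hb hbh (by rw [hx', hx, hrho]) hbr
  have hpos : 0 < rhoL G := rhoL_pos (u := a) (v := h) (by simp [dist_eq_one_iff_adj.2 hh])
  have hzero : energy G x = 0 :=
    Finset.sum_eq_zero fun u _ => Finset.sum_eq_zero fun v _ => by
      rw [hconst u, hconst v, sub_self]
      simp
  have := mul_pos hpos hxx
  linarith

end Maximal

end DistLap

theorem theorem2p4 {V : Type*} [Fintype V] [DecidableEq V] (n k : ℕ)
    (hn : Fintype.card V = n) (hk : 2 ≤ k) (hkn : k + 2 ≤ n)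
    (T : SimpleGraph V) (hT : T ∈ DistLap.treesWithPendants V k)
    (hmax : ∀ T' ∈ DistLap.treesWithPendants V k, DistLap.rhoL T' ≤ DistLap.rhoL T) :
    DistLap.IsInD n k T :=
  DistLap.isInD_of_noInnerBranching hT.1 (DistLap.noInnerBranching_of_maximal hT hmax) hn hT.2 hkn
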